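/- An incremental graph sequence of length $T$ consists of an initial finite simple undirected edge-weighted graph $G_0$ and graphs $G_1,\dots,G_T$, where each $G_t=(V_t,E_t,w)$ arises from $G_{t-1}$ by inserting a set of new nodes and a set of new weighted edges; nothing is ever deleted and weights do not change. Two incremental graph sequences $\mathcal G,\mathcal G'$ of the same length and with the same initial graph are node-adjacent if, up to exchanging them, there are a node $v^*$ and a time $t^*$ such that: $v^*$ is inserted into $\mathcal G$ at time $t^*$; $\mathcal G'$ inserts the same nodes at the same times except that it omits the insertion of $v^*$; every edge inserted into $\mathcal G$ at a time $t$ is incident to a node inserted into $\mathcal G$ at time $t$; and the edges inserted into $\mathcal G'$ at time $t$ are exactly the edges inserted into $\mathcal G$ at time $t$ that are not incident to $v^*$, with the same weights. Let $w_{\mathrm{MST}}(G)$ be the weight of a minimum spanning tree of $G$ (of a minimum spanning forest if $G$ is disconnected). For $D,W,T\in\mathbb N$ let $\mathcal S_{D,W,T}$ be the set of incremental graph sequences of length $T$ in which all graphs $G_0,\dots,G_T$ have maximum degree at most $D$ and edge weights in $\{1,\dots,W\}$. An algorithm under continual observation reads $G_0,G_1,\dots,G_T$ and outputs a real number $a_t$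 at every time $t=1,\dots,T$, which depends only on its random coins and on $G_0,\dots,G_t$. It is $\varepsilon$-node-differentially private on $\mathcal S_{D,W,T}$ if $\Pr[a(\mathcal G)\in B]\le e^{\varepsilon}\Pr[a(\mathcal G')\in B]$ for all node-adjacent $\mathcal G,\mathcal G'\in\mathcal S_{D,W,T}$ and all measurable $B\subseteq\mathbb R^T$, where $a=(a_1,\dots,a_T)$. **Theorem.** (i) For all $D,W,T$, the continuous global sensitivity of the difference sequence of the minimum spanning tree weight on $\mathcal S_{D,W,T}$ under node-adjacency is at most $2DW$, that is, $$\sum_{t=1}^{T}\bigl|\bigl(w_{\mathrm{MST}}(G_t)-w_{\mathrm{MST}}(G_{t-1})\bigr)-\bigl(w_{\mathrm{MST}}(G'_t)-w_{\mathrm{MST}}(G'_{t-1})\bigr)\bigr|\le 2DW$$ for all node-adjacent $\mathcal G,\mathcal G'\in\mathcal S_{D,W,T}$. (ii) There is an absolute constant $C>0$ such that for all $T\ge 2$, all $D,W\in\mathbb N$ and all $\varepsilon>0$ there is an algorithm under continual observation that is $\varepsilon$-node-differentially private on $\mathcal S_{D,W,T}$ and such that for every $\delta\in(0,1)$, every $\mathcal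 G\in\mathcal S_{D,W,T}$ and every time $t\in\{1,\dots,T\}$, with probability at least $1-\delta$, $$\bigl|a_t-w_{\mathrm{MST}}(G_t)\bigr|\le C\cdot D\,W\,\varepsilon^{-1}\,\log^{3/2}T\,\log\delta^{-1}.$$ -/

import Mathlib

open MeasureTheory
open scoped ENNReal

/-- A finite simple undirected edge-weighted graph `(V, E, w)` whose nodes are taken from a universe
`V` of possible nodes. The weight function `w : E → ℕ` is stored as a function on all pairs that
vanishes outside `E`, so that two such graphs are equal iff they have the same nodes, the same edges
and the same edge weights. -/
@[ext]
structure WeightedGraph (V : Type*) where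
  verts : Finset V
  edges : Finset (Sym2 V)
  weight : Sym2 V → ℕ
  loopless : ∀ e ∈ edges, ¬ e.IsDiag
  endpoints_mem : ∀ e ∈ edges, ∀ v ∈ e, v ∈ verts
  weight_eq_zero : ∀ e, e ∉ edges → weight e = 0

namespace WeightedGraph

variable {V : Type*}

/-- `F` is the edge set of a spanning forest of `G`, i.e. of a spanning tree of every connected
component of `G`. If `G` is connected, these are exactly the spanning trees of `G`. -/
def IsSpanningForest (G : WeightedGraph V) (F : Finset (Sym2 V)) : Prop :=
  F ⊆ G.edges ∧
  (SimpleGraph.fromEdgeSet (F : Set (Sym2 V))).IsAcyclic ∧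
  ∀ u v : V, (SimpleGraph.fromEdgeSet (G.edges : Set (Sym2 V))).Reachable u v →
    (SimpleGraph.fromEdgeSet (F : Set (Sym2 V))).Reachable u v

/-- A spanning forest always exists, so the infimum in `mstWeight` is a minimum. -/
theorem exists_isSpanningForest (G : WeightedGraph V) : ∃ F, G.IsSpanningForest F := by
  obtain ⟨H, hle, hac, hr⟩ :=
    (SimpleGraph.fromEdgeSet (G.edges : Set (Sym2 V))).exists_isAcyclic_reachable_eq_le
  have hsub : H.edgeSet ⊆ (G.edges : Set (Sym2 V)) := by
    intro e he
    have h1 := SimpleGraph.edgeSet_mono hle he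
    rw [SimpleGraph.edgeSet_fromEdgeSet] at h1
    exact h1.1
  have hfin : H.edgeSet.Finite := G.edges.finite_toSet.subset hsub
  have hF : SimpleGraph.fromEdgeSet (hfin.toFinset : Set (Sym2 V)) = H := by
    rw [Set.Finite.coe_toFinset, SimpleGraph.fromEdgeSet_edgeSet]
  refine ⟨hfin.toFinset, ?_, ?_, ?_⟩
  · intro e he
    exact hsub (hfin.mem_toFinset.mp he)
  · rw [hF]
    exact hac
  · intro u v huv
    rw [hF, hr]
    exact huv

/-- The weight of a minimum spanning tree (of a minimum spanning forest, if `G` is not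
connected). -/
noncomputable def mstWeight (G : WeightedGraph V) : ℕ :=
  sInf {n : ℕ | ∃ F : Finset (Sym2 V), G.IsSpanningForest F ∧ n = ∑ e ∈ F, G.weight e}

/-- The degree of a node. -/
noncomputable def degree (G : WeightedGraph V) (v : V) : ℕ :=
  {e : Sym2 V | e ∈ G.edges ∧ v ∈ e}.ncard

end WeightedGraph

/-- An incremental graph sequence `(G₁, …, G_T)` of length `T` with initial graph `G₀`: the graph
`G_t` is `graph t`, and it is derived from `G_{t-1}` by inserting nodes and (weighted) edges only. -/
structure IncrementalSeq (V : Type*) (T : ℕ) where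
  graph : Fin (T + 1) → WeightedGraph V
  verts_subset : ∀ t : Fin T, (graph t.castSucc).verts ⊆ (graph t.succ).verts
  edges_subset : ∀ t : Fin T, (graph t.castSucc).edges ⊆ (graph t.succ).edges
  weight_eq : ∀ t : Fin T, ∀ e ∈ (graph t.castSucc).edges,
    (graph t.succ).weight e = (graph t.castSucc).weight e

namespace IncrementalSeq

variable {V : Type*} {T : ℕ}

/-- The set of nodes inserted by the update that leads from `graph t.castSucc` to `graph t.succ`. -/
def insertedVerts (S : IncrementalSeq V T) (t : Fin T) : Set V :=
  {v | v ∈ (S.graph t.succ).verts ∧ v ∉ (S.graph t.castSucc).verts}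

/-- The set of edges inserted by the update that leads from `graph t.castSucc` to
`graph t.succ`. -/
def insertedEdges (S : IncrementalSeq V T) (t : Fin T) : Set (Sym2 V) :=
  {e | e ∈ (S.graph t.succ).edges ∧ e ∉ (S.graph t.castSucc).edges}

/-- All degrees are at most `D` and all edge weights are in `{1, …, W}`, at all times. -/
def Bounded (S : IncrementalSeq V T) (D W : ℕ) : Prop :=
  ∀ t : Fin (T + 1),
    (∀ v : V, (S.graph t).degree v ≤ D) ∧
    (∀ e ∈ (S.graph t).edges, 1 ≤ (S.graph t).weight e ∧ (S.graph t).weight e ≤ W)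

/-- `S` and `S'` start from the same graph, and `S'` arises from `S` by omitting the insertion of
one node `vstar`, together with all edges incident to it. All edges are inserted together with at
least one of their endpoints. -/
def NodeAdjacentOn (S S' : IncrementalSeq V T) (vstar : V) : Prop :=
  S.graph 0 = S'.graph 0 ∧
  (∃ tstar : Fin T,
    vstar ∈ S.insertedVerts tstar ∧
    S'.insertedVerts tstar = S.insertedVerts tstar \ {vstar} ∧
    ∀ t : Fin T, t ≠ tstar → S'.insertedVerts t = S.insertedVerts t) ∧
  (∀ t : Fin T, ∀ e ∈ S.insertedEdges t, ∃ v ∈ e, v ∈ S.insertedVerts t) ∧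
  (∀ t : Fin T, S'.insertedEdges t = {e | e ∈ S.insertedEdges t ∧ vstar ∉ e}) ∧
  (∀ t : Fin T, ∀ e ∈ S'.insertedEdges t,
    (S'.graph t.succ).weight e = (S.graph t.succ).weight e)

/-- Node-adjacency (on event-level), a symmetric relation. -/
def NodeAdjacent (S S' : IncrementalSeq V T) : Prop :=
  ∃ vstar : V, NodeAdjacentOn S S' vstar ∨ NodeAdjacentOn S' S vstar

/-- The difference sequence `Δf(t) = f(G_t) - f(G_{t-1})` of a graph function `f`. -/
def diffSeq (f : WeightedGraph V → ℝ) (S : IncrementalSeq V T) (t : Fin T) : ℝ :=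
  f (S.graph t.succ) - f (S.graph t.castSucc)

end IncrementalSeq

/-- The continuous global sensitivity of the difference sequence of `f` under node-adjacency, on
incremental graph sequences of length `T` with maximum degree at most `D` and edge weights in
`{1, …, W}`. -/
noncomputable def nodeSensitivity {V : Type*} (f : WeightedGraph V → ℝ) (T D W : ℕ) : ℝ≥0∞ :=
  ⨆ (S : IncrementalSeq V T) (S' : IncrementalSeq V T)
    (_ : S.Bounded D W ∧ S'.Bounded D W ∧ S.NodeAdjacent S'),
    ENNReal.ofReal (∑ t : Fin T, |S.diffSeq f t - S'.diffSeq f t|)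

/-- A randomized algorithm under continual observation, for incremental graph sequences of length
`T`. It draws its random coins from a probability space, reads the graph sequence, and outputs a
real number at each time `1, …, T`, where its output at a time depends only on its coins and on the
part of the sequence seen so far. -/
structure ContinualAlgorithm (V : Type*) (T : ℕ) where
  Coins : Type
  [measurableSpace : MeasurableSpace Coins]
  law : Measure Coins
  [isProbabilityMeasure : IsProbabilityMeasure law]
  output : IncrementalSeq V T → Coins → Fin T → ℝ
  measurable_output : ∀ S, Measurable (output S)
  causal : ∀ (S S' : IncrementalSeq V T) (t : Fin T),
    (∀ s : Fin (T + 1), s ≤ t.succ → S.graph s = S'.graph s) →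
    ∀ ω, output S ω t = output S' ω t

namespace ContinualAlgorithm

variable {V : Type*} {T : ℕ}

/-- The probability that the random outcome `ω` of the coins satisfies `p`. -/
noncomputable def pr (A : ContinualAlgorithm V T) (p : A.Coins → Prop) : ℝ :=
  (@Measure.real A.Coins A.measurableSpace A.law {ω | p ω})

/-- `A` is `ε`-node-differentially private on incremental graph sequences with maximum degree at
most `D` and edge weights in `{1, …, W}`. -/
def NodePrivate (A : ContinualAlgorithm V T) (ε : ℝ) (D W : ℕ) : Prop :=
  ∀ S S' : IncrementalSeq V T, S.Bounded D W → S'.Bounded D W → S.NodeAdjacent S' →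
    ∀ B : Set (Fin T → ℝ), MeasurableSet B →
      A.pr (fun ω => A.output S ω ∈ B) ≤ Real.exp ε * A.pr (fun ω => A.output S' ω ∈ B)

end ContinualAlgorithm

/-! (i) Let `r` be the graphic rank, realised as linear rank over `ZMod 2`. Kruskal's forest is
optimal on every sublevel set, so the minimum weight is the sum over `i < W` of `r(E) - r(E_{≤i})`.
Deleting the star of `v` changes `r(A)` by the degree of `v` in `A` minus a redundancy `ρ(A)`, which
is monotone in `A` by submodularity (`starRedundancy_mono`). The two MST weights therefore differ by
the sum over `i < W` of `deg_{>i}(v) - ρ(E) + ρ(E_{≤i})`. All three quantities start at 0 and only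
grow with time, and their final values add up to at most `2 * deg(v)`. The difference thus has total
variation at most `2DW` (`NodeAdjacentOn.sum_abs_le`).

(ii) The binary tree mechanism puts Laplace noise on dyadic nodes. A sequence of variation `R` is a
sequence of path sums of a vector with `ℓ¹` norm at most `(log₂ T + 1) R`
(`exists_sum_dyadicPath_eq`); shifting the noise by that vector turns one run into the other, which
gives privacy. Each output sees about `log T` noise terms, and a Chernoff bound controls them at
scale `√(log T)`. As `δ → 1` the permitted error tends to 0, where a tail bound `4 * exp (-a)` says
nothing; an independent uniform variable, harmless for privacy, smooths the noise and covers this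
range. -/

/-! ### Graphic matroid as a linear matroid over `ZMod 2` -/

/-- The characteristic vector over `ZMod 2` of the pair of endpoints of an edge (zero on loops). -/
noncomputable def incidenceVec {V : Type*} (e : Sym2 V) : V →₀ ZMod 2 :=
  Sym2.lift ⟨fun u v => Finsupp.single u 1 + Finsupp.single v 1, fun _ _ => add_comm _ _⟩ e

/-- The rank of a set of edges in the graphic matroid. -/
noncomputable def edgeRank {V : Type*} (A : Finset (Sym2 V)) : ℕ :=
  Module.finrank (ZMod 2) (Submodule.span (ZMod 2) (incidenceVec '' (A : Set (Sym2 V))))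

section GraphicMatroid

variable {V : Type*}

open Submodule

theorem incidenceVec_mk (u v : V) :
    incidenceVec s(u, v) = Finsupp.single u (1 : ZMod 2) + Finsupp.single v 1 := rfl

theorem incidenceVec_self (u : V) : incidenceVec s(u, u) = 0 := by
  rw [incidenceVec_mk, ← Finsupp.single_add, CharTwo.add_self_eq_zero, Finsupp.single_zero]

/-- Along a walk the edge vectors telescope to the vector of its two ends. Conversely, summing
coordinates over the component of `u` is a functional that vanishes on `A` but not on the pair `u,
v` when they are separated. -/
theorem incidenceVec_mem_span_iff (A : Set (Sym2 V)) (u v : V) :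
    incidenceVec s(u, v) ∈ span (ZMod 2) (incidenceVec '' A) ↔
      (SimpleGraph.fromEdgeSet A).Reachable u v := by
  classical
  constructor
  · intro h
    by_contra hn
    let φ : (V →₀ ZMod 2) →ₗ[ZMod 2] ZMod 2 := Finsupp.linearCombination (ZMod 2)
      (fun x => if (SimpleGraph.fromEdgeSet A).Reachable u x then (1 : ZMod 2) else 0)
    have hle : span (ZMod 2) (incidenceVec '' A) ≤ LinearMap.ker φ := by
      rw [span_le]
      rintro _ ⟨e, he, rfl⟩
      induction e using Sym2.ind with
      | _ a b =>
        by_cases hab : a = b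
        · subst hab
          rw [incidenceVec_self]
          exact zero_mem _
        · have hadj : (SimpleGraph.fromEdgeSet A).Adj a b := by
            rw [SimpleGraph.fromEdgeSet_adj]
            exact ⟨he, hab⟩
          have hiff : (SimpleGraph.fromEdgeSet A).Reachable u a ↔
              (SimpleGraph.fromEdgeSet A).Reachable u b :=
            ⟨fun h => h.trans hadj.reachable, fun h => h.trans hadj.symm.reachable⟩
          simp only [SetLike.mem_coe, LinearMap.mem_ker, φ, incidenceVec_mk, map_add,
            Finsupp.linearCombination_single, one_smul, hiff]
          exact CharTwo.add_self_eq_zero _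
    have := hle h
    simp [φ, incidenceVec_mk, hn] at this
  · rintro ⟨p⟩
    induction p with
    | nil => rw [incidenceVec_self]; exact zero_mem _
    | @cons a b c hab p ih =>
      rw [SimpleGraph.fromEdgeSet_adj] at hab
      have h1 : incidenceVec s(a, b) ∈ span (ZMod 2) (incidenceVec '' A) :=
        subset_span ⟨_, hab.1, rfl⟩
      have h2 : incidenceVec s(a, c) = incidenceVec s(a, b) + incidenceVec s(b, c) := by
        have : Finsupp.single b (1 : ZMod 2) + Finsupp.single b 1 = 0 := by
          rw [← Finsupp.single_add, CharTwo.add_self_eq_zero, Finsupp.single_zero]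
        rw [incidenceVec_mk, incidenceVec_mk, incidenceVec_mk, add_assoc,
          ← add_assoc (Finsupp.single b (1 : ZMod 2)), this, zero_add]
      rw [h2]
      exact add_mem h1 ih

/-- Acyclic means every edge is a bridge, i.e. its vector lies outside the span of the others. Loops
must be excluded: `fromEdgeSet` drops them, but their vector is zero. -/
theorem isAcyclic_fromEdgeSet_iff_linearIndepOn {A : Set (Sym2 V)} (hA : ∀ e ∈ A, ¬ e.IsDiag) :
    (SimpleGraph.fromEdgeSet A).IsAcyclic ↔ LinearIndepOn (ZMod 2) incidenceVec A := by
  rw [SimpleGraph.isAcyclic_iff_forall_isBridge, linearIndepOn_iff_notMem_span]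
  have hE : (SimpleGraph.fromEdgeSet A).edgeSet = A := by
    rw [SimpleGraph.edgeSet_fromEdgeSet]
    ext e
    simpa using hA e
  rw [hE]
  refine forall_congr' fun e => forall_congr' fun _ => ?_
  induction e using Sym2.ind with
  | _ a b =>
    rw [incidenceVec_mem_span_iff, SimpleGraph.isBridge_iff,
      SimpleGraph.deleteEdges_fromEdgeSet]

theorem isSpanningForest_iff_linearIndepOn {G : WeightedGraph V} {F : Finset (Sym2 V)} :
    G.IsSpanningForest F ↔ F ⊆ G.edges ∧ LinearIndepOn (ZMod 2) incidenceVec (F : Set (Sym2 V)) ∧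
      incidenceVec '' (G.edges : Set (Sym2 V)) ⊆
        span (ZMod 2) (incidenceVec '' (F : Set (Sym2 V))) := by
  unfold WeightedGraph.IsSpanningForest
  refine and_congr_right fun hF => and_congr ?_ ?_
  · exact isAcyclic_fromEdgeSet_iff_linearIndepOn fun e he => G.loopless e (hF he)
  · constructor
    · rintro h _ ⟨e, he, rfl⟩
      induction e using Sym2.ind with
      | _ a b =>
        refine (incidenceVec_mem_span_iff _ _ _).2 (h a b ?_)
        exact (incidenceVec_mem_span_iff _ _ _).1 (subset_span ⟨_, he, rfl⟩)
    · intro h u v huv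
      rw [← incidenceVec_mem_span_iff] at huv ⊢
      exact span_le.2 h huv

instance finiteDimensional_span_incidenceVec (A : Finset (Sym2 V)) :
    FiniteDimensional (ZMod 2) (span (ZMod 2) (incidenceVec '' (A : Set (Sym2 V)))) :=
  FiniteDimensional.span_of_finite _ (A.finite_toSet.image _)

theorem edgeRank_mono {A B : Finset (Sym2 V)} (h : A ⊆ B) : edgeRank A ≤ edgeRank B :=
  Submodule.finrank_mono (span_mono (Set.image_mono (Finset.coe_subset.2 h)))

theorem edgeRank_eq_card {F : Finset (Sym2 V)}
    (hF : LinearIndepOn (ZMod 2) incidenceVec (F : Set (Sym2 V))) : edgeRank F = F.card := by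
  have h := finrank_span_eq_card (b := fun x : (F : Set (Sym2 V)) => incidenceVec (x : Sym2 V)) hF
  rw [edgeRank, Set.image_eq_range]
  simpa using h

theorem edgeRank_le_card (A : Finset (Sym2 V)) : edgeRank A ≤ A.card := by
  have h := finrank_range_le_card (R := ZMod 2)
    (fun x : (A : Set (Sym2 V)) => incidenceVec (x : Sym2 V))
  rw [edgeRank, Set.image_eq_range]
  simpa [Set.finrank] using h

theorem edgeRank_eq_of_subset_span {A B : Finset (Sym2 V)} (h : A ⊆ B)
    (hs : incidenceVec '' (B : Set (Sym2 V)) ⊆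
      span (ZMod 2) (incidenceVec '' (A : Set (Sym2 V)))) : edgeRank A = edgeRank B :=
  le_antisymm (edgeRank_mono h) (Submodule.finrank_mono (span_le.2 hs))

/-- Submodularity of rank, from the dimension formula: the span of an intersection may be smaller
than the intersection of the spans. -/
theorem edgeRank_union_add_inter_le [DecidableEq V] (A B : Finset (Sym2 V)) :
    edgeRank (A ∪ B) + edgeRank (A ∩ B) ≤ edgeRank A + edgeRank B := by
  have h1 := Submodule.finrank_sup_add_finrank_inf_eq
    (span (ZMod 2) (incidenceVec '' (A : Set (Sym2 V))))
    (span (ZMod 2) (incidenceVec '' (B : Set (Sym2 V))))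
  rw [← span_union, ← Set.image_union, ← Finset.coe_union] at h1
  have h2 : span (ZMod 2) (incidenceVec '' ((A ∩ B : Finset (Sym2 V)) : Set (Sym2 V))) ≤
      span (ZMod 2) (incidenceVec '' (A : Set (Sym2 V))) ⊓
        span (ZMod 2) (incidenceVec '' (B : Set (Sym2 V))) :=
    le_inf (span_mono (Set.image_mono (by simp))) (span_mono (Set.image_mono (by simp)))
  exact (Nat.add_le_add_left (Submodule.finrank_mono h2) _).trans h1.le

theorem edgeRank_union_le [DecidableEq V] (A B : Finset (Sym2 V)) :
    edgeRank (A ∪ B) ≤ edgeRank A + B.card := by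
  have h1 := edgeRank_union_add_inter_le A B
  have h2 := edgeRank_le_card B
  omega

end GraphicMatroid

/-! ### Kruskal's algorithm and the rank formula for the MST weight -/

section MinimumSpanningForest

variable {V : Type*}

open Submodule

/-- A forest that spans every sublevel set `w ≤ i` of the edge weights. -/
theorem exists_linearIndepOn_forall_sublevel (E : Finset (Sym2 V)) (w : Sym2 V → ℕ) (k : ℕ) :
    ∃ F ⊆ E, (∀ e ∈ F, w e ≤ k) ∧ LinearIndepOn (ZMod 2) incidenceVec (F : Set (Sym2 V)) ∧
      ∀ i ≤ k, incidenceVec '' (E.filter (w · ≤ i) : Set (Sym2 V)) ⊆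
        span (ZMod 2) (incidenceVec '' (F.filter (w · ≤ i) : Set (Sym2 V))) := by
  classical
  -- The greedy step: an independent set inside a sublevel set extends to a basis of it, keeping
  -- what was already chosen.
  have key : ∀ (k : ℕ) (F₀ : Finset (Sym2 V)), F₀ ⊆ E.filter (w · ≤ k) →
      LinearIndepOn (ZMod 2) incidenceVec (F₀ : Set (Sym2 V)) →
      ∃ F : Finset (Sym2 V), F ⊆ E.filter (w · ≤ k) ∧ F₀ ⊆ F ∧
        LinearIndepOn (ZMod 2) incidenceVec (F : Set (Sym2 V)) ∧
        incidenceVec '' (E.filter (w · ≤ k) : Set (Sym2 V)) ⊆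
          span (ZMod 2) (incidenceVec '' (F : Set (Sym2 V))) := by
    intro k F₀ hF₀ hli
    obtain ⟨b, hb1, hb2, hb3, hb4⟩ := exists_linearIndepOn_extension hli
      (Finset.coe_subset.2 hF₀)
    have hfin : b.Finite := (Finset.finite_toSet _).subset hb1
    refine ⟨hfin.toFinset, ?_, ?_, ?_, ?_⟩
    · rw [← Finset.coe_subset]; simpa using hb1
    · rw [← Finset.coe_subset]; simpa using hb2
    · simpa using hb4
    · simpa using hb3
  induction k with
  | zero =>
    obtain ⟨F, h1, -, h3, h4⟩ := key 0 ∅ (by simp) (by simp)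
    refine ⟨F, fun e he => (Finset.mem_filter.1 (h1 he)).1,
      fun e he => (Finset.mem_filter.1 (h1 he)).2, h3, fun i hi => ?_⟩
    obtain rfl : i = 0 := by omega
    rwa [Finset.filter_true_of_mem (s := F) fun e he => (Finset.mem_filter.1 (h1 he)).2]
  | succ k ih =>
    obtain ⟨F₀, a1, a2, a3, a4⟩ := ih
    obtain ⟨F, h1, h2, h3, h4⟩ := key (k + 1) F₀
      (fun e he => Finset.mem_filter.2 ⟨a1 he, (a2 e he).trans (Nat.le_succ k)⟩) a3
    refine ⟨F, fun e he => (Finset.mem_filter.1 (h1 he)).1,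
      fun e he => (Finset.mem_filter.1 (h1 he)).2, h3, fun i hi => ?_⟩
    rcases Nat.lt_or_ge k i with hki | hki
    · obtain rfl : i = k + 1 := by omega
      rwa [Finset.filter_true_of_mem (s := F) fun e he => (Finset.mem_filter.1 (h1 he)).2]
    · exact (a4 i hki).trans (span_mono (Set.image_mono
        (Finset.coe_subset.2 (Finset.filter_subset_filter _ h2))))

/-- An edge of weight `w e` lies in the sublevel sets of exactly `W - w e` thresholds below `W`. The
additive form avoids truncated subtraction. -/
theorem sum_add_sum_card_sublevel (F : Finset (Sym2 V)) (w : Sym2 V → ℕ) (W : ℕ)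
    (hw : ∀ e ∈ F, w e ≤ W) :
    ∑ e ∈ F, w e + ∑ i ∈ Finset.range W, (F.filter (w · ≤ i)).card = W * F.card := by
  simp_rw [Finset.card_filter]
  rw [Finset.sum_comm, ← Finset.sum_add_distrib, mul_comm, ← smul_eq_mul, ← Finset.sum_const]
  refine Finset.sum_congr rfl fun e he => ?_
  rw [← Finset.card_filter]
  have : (Finset.range W).filter (fun i => w e ≤ i) = Finset.Ico (w e) W := by
    ext i; simp; omega
  rw [this, Nat.card_Ico]
  have := hw e he
  omega

/-- The weight of a minimum spanning forest in terms of the ranks of the sublevel sets of the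
weight function. -/
theorem WeightedGraph.mstWeight_add_sum_edgeRank (G : WeightedGraph V) (W : ℕ)
    (hW : ∀ e ∈ G.edges, G.weight e ≤ W) :
    G.mstWeight + ∑ i ∈ Finset.range W, edgeRank (G.edges.filter (G.weight · ≤ i))
      = W * edgeRank G.edges := by
  obtain ⟨F, h1, -, h3, h4⟩ := exists_linearIndepOn_forall_sublevel G.edges G.weight W
  have hEW : G.edges.filter (G.weight · ≤ W) = G.edges := Finset.filter_true_of_mem hW
  have hFW : F.filter (G.weight · ≤ W) = F := Finset.filter_true_of_mem fun e he => hW e (h1 he)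
  have hspan := h4 W le_rfl
  rw [hEW, hFW] at hspan
  have hF : G.IsSpanningForest F := isSpanningForest_iff_linearIndepOn.2 ⟨h1, h3, hspan⟩
  have hsub : ∀ F' : Finset (Sym2 V), LinearIndepOn (ZMod 2) incidenceVec (F' : Set (Sym2 V)) →
      ∀ i, edgeRank (F'.filter (G.weight · ≤ i)) = (F'.filter (G.weight · ≤ i)).card :=
    fun F' hF' i => edgeRank_eq_card (hF'.mono (Finset.coe_subset.2 (Finset.filter_subset _ _)))
  have hcard : ∀ F', G.IsSpanningForest F' → F'.card = edgeRank G.edges := fun F' hF' => by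
    obtain ⟨b1, b2, b3⟩ := isSpanningForest_iff_linearIndepOn.1 hF'
    rw [← edgeRank_eq_card b2, edgeRank_eq_of_subset_span b1 b3]
  have hFsum := sum_add_sum_card_sublevel F G.weight W fun e he => hW e (h1 he)
  have hranks : ∑ i ∈ Finset.range W, edgeRank (G.edges.filter (G.weight · ≤ i))
      = ∑ i ∈ Finset.range W, (F.filter (G.weight · ≤ i)).card := by
    refine Finset.sum_congr rfl fun i hi => ?_
    rw [← hsub F h3, edgeRank_eq_of_subset_span (Finset.filter_subset_filter _ h1)
      (h4 i (Finset.mem_range.1 hi).le)]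
  rw [hranks, ← hcard F hF, ← hFsum, Nat.add_right_cancel_iff]
  refine le_antisymm (Nat.sInf_le ⟨F, hF, rfl⟩) (le_csInf ⟨_, F, hF, rfl⟩ ?_)
  rintro n ⟨F', hF', rfl⟩
  obtain ⟨b1, b2, -⟩ := isSpanningForest_iff_linearIndepOn.1 hF'
  have hsum' := sum_add_sum_card_sublevel F' G.weight W fun e he => hW e (b1 he)
  -- Any forest meets a sublevel set in at most its rank many edges; the greedy forest attains this
  -- at every threshold at once, hence is lightest.
  have hle : ∑ i ∈ Finset.range W, (F'.filter (G.weight · ≤ i)).card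
      ≤ ∑ i ∈ Finset.range W, (F.filter (G.weight · ≤ i)).card := by
    rw [← hranks]
    refine Finset.sum_le_sum fun i _ => ?_
    rw [← hsub F' b2]
    exact edgeRank_mono (Finset.filter_subset_filter _ b1)
  rw [hcard F' hF', ← hcard F hF] at hsum'
  omega

end MinimumSpanningForest

/-! ### Redundant edges in the star of a node -/

section StarRedundancy

variable {V : Type*}

open scoped Classical in
/-- The number of edges of `A` at the node `v` that are redundant for the rank of `A`. -/
noncomputable def starRedundancy (v : V) (A : Finset (Sym2 V)) : ℝ :=
  (A.filter (v ∈ ·)).card + edgeRank (A.filter (v ∉ ·)) - edgeRank A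

/-- Submodularity for `B` without the star of `v` and for `A`: these intersect in `A` without the
star. Their union lacks only the star edges in `B \ A`, each of which raises the rank by at most
one. -/
theorem starRedundancy_mono (v : V) {A B : Finset (Sym2 V)} (h : A ⊆ B) :
    starRedundancy v A ≤ starRedundancy v B := by
  classical
  have hcard : (B.filter (v ∈ ·)).card =
      (A.filter (v ∈ ·)).card + (B.filter (v ∈ ·) \ A).card := by
    rw [← Finset.card_inter_add_card_sdiff (B.filter (v ∈ ·)) A]
    congr 2
    grind
  have h1 := edgeRank_union_add_inter_le (B.filter (v ∉ ·)) A
  have h2 := edgeRank_union_le (B.filter (v ∉ ·) ∪ A) (B.filter (v ∈ ·) \ A)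
  have e1 : B.filter (v ∉ ·) ∩ A = A.filter (v ∉ ·) := by grind
  have e2 : B.filter (v ∉ ·) ∪ A ∪ (B.filter (v ∈ ·) \ A) = B := by grind
  rw [e1] at h1
  rw [e2] at h2
  have h3 : (edgeRank B : ℝ) + edgeRank (A.filter (v ∉ ·)) ≤
      edgeRank (B.filter (v ∉ ·)) + edgeRank A + (B.filter (v ∈ ·) \ A).card := by
    exact_mod_cast (by omega)
  have h4 : ((B.filter (v ∈ ·)).card : ℝ) =
    (A.filter (v ∈ ·)).card + (B.filter (v ∈ ·) \ A).card := by exact_mod_cast hcard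
  unfold starRedundancy
  linarith

open scoped Classical in
theorem starRedundancy_le_card (v : V) (A : Finset (Sym2 V)) :
    starRedundancy v A ≤ (A.filter (v ∈ ·)).card := by
  have : (edgeRank (A.filter (v ∉ ·)) : ℝ) ≤ edgeRank A := by
    exact_mod_cast edgeRank_mono (Finset.filter_subset _ _)
  unfold starRedundancy
  linarith

theorem starRedundancy_eq_zero {v : V} {A : Finset (Sym2 V)} (h : ∀ e ∈ A, v ∉ e) :
    starRedundancy v A = 0 := by
  classical
  unfold starRedundancy
  rw [Finset.filter_true_of_mem h, Finset.filter_false_of_mem h]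
  simp

end StarRedundancy

/-! ### Continuous global sensitivity under node-adjacency -/

theorem sum_abs_sub_eq_of_monotone {T : ℕ} {f : Fin (T + 1) → ℝ} (hf : Monotone f) :
    ∑ t : Fin T, |f t.succ - f t.castSucc| = f (Fin.last T) - f 0 := by
  have h : ∀ t : Fin T, |f t.succ - f t.castSucc| = f t.succ - f t.castSucc := fun t =>
    abs_of_nonneg (sub_nonneg.2 (hf (Fin.castSucc_lt_succ).le))
  simp_rw [h]
  rw [Finset.sum_sub_distrib]
  have h1 := Fin.sum_univ_castSucc f
  have h2 := Fin.sum_univ_succ f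
  linarith

namespace IncrementalSeq

variable {V : Type*} {T : ℕ}

theorem verts_mono (S : IncrementalSeq V T) : Monotone fun t => (S.graph t).verts :=
  Fin.monotone_iff_le_succ.2 S.verts_subset

theorem edges_mono (S : IncrementalSeq V T) : Monotone fun t => (S.graph t).edges :=
  Fin.monotone_iff_le_succ.2 S.edges_subset

theorem sublevel_mono (S : IncrementalSeq V T) (p : ℕ → Prop) [DecidablePred p] :
    Monotone fun t => (S.graph t).edges.filter fun e => p ((S.graph t).weight e) := by
  refine Fin.monotone_iff_le_succ.2 fun t e he => ?_
  rw [Finset.mem_filter] at he ⊢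
  exact ⟨S.edges_subset t he.1, by rw [S.weight_eq t e he.1]; exact he.2⟩

variable {S S' : IncrementalSeq V T} {v : V}

theorem NodeAdjacentOn.notMem_of_mem_edges_zero (h : NodeAdjacentOn S S' v) :
    ∀ e ∈ (S.graph 0).edges, v ∉ e := by
  obtain ⟨-, ⟨t, ht, -⟩, -⟩ := h
  intro e he hv
  exact ht.2 (S.verts_mono (Fin.zero_le _) ((S.graph 0).endpoints_mem e he v hv))

open scoped Classical in
theorem NodeAdjacentOn.edges_eq (h : NodeAdjacentOn S S' v) (t : Fin (T + 1)) :
    (S'.graph t).edges = (S.graph t).edges.filter (v ∉ ·) := by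
  induction t using Fin.induction with
  | zero => rw [Finset.filter_true_of_mem h.notMem_of_mem_edges_zero, h.1]
  | succ t ih =>
    have h4 := Set.ext_iff.1 (h.2.2.2.1 t)
    ext e
    have h5 := h4 e
    simp only [insertedEdges, Set.mem_ofPred_eq] at h5
    have h6 := Finset.ext_iff.1 ih e
    have h7 : e ∈ (S.graph t.castSucc).edges → e ∈ (S.graph t.succ).edges :=
      fun h => S.edges_subset t h
    have h8 : e ∈ (S'.graph t.castSucc).edges → e ∈ (S'.graph t.succ).edges :=
      fun h => S'.edges_subset t h
    rw [Finset.mem_filter] at h6 ⊢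
    tauto

theorem NodeAdjacentOn.weight_eq (h : NodeAdjacentOn S S' v) (t : Fin (T + 1)) :
    ∀ e ∈ (S'.graph t).edges, (S'.graph t).weight e = (S.graph t).weight e := by
  classical
  induction t using Fin.induction with
  | zero => intro e _; rw [h.1]
  | succ t ih =>
    intro e he
    by_cases hc : e ∈ (S'.graph t.castSucc).edges
    · have hS : e ∈ (S.graph t.castSucc).edges := by
        rw [h.edges_eq] at hc
        exact (Finset.mem_filter.1 hc).1
      rw [S'.weight_eq t e hc, S.weight_eq t e hS, ih e hc]
    · exact h.2.2.2.2 t e ⟨he, hc⟩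

open scoped Classical in
-- Subtracting the two rank formulas leaves, per threshold, the rank lost with the star in `E` minus
-- that lost in `E_{≤i}`. Writing each loss as degree minus redundancy, the degrees combine to the
-- count of star edges heavier than `i`, so only monotone terms remain.
theorem NodeAdjacentOn.mstWeight_sub (h : NodeAdjacentOn S S' v) {D W : ℕ}
    (hS : S.Bounded D W) (hS' : S'.Bounded D W) (t : Fin (T + 1)) :
    ((S.graph t).mstWeight : ℝ) - (S'.graph t).mstWeight =
      ∑ i ∈ Finset.range W,
        (((((S.graph t).edges.filter fun e => ¬ (S.graph t).weight e ≤ i).filter (v ∈ ·)).card : ℝ)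
        - starRedundancy v (S.graph t).edges
        + starRedundancy v ((S.graph t).edges.filter fun e => (S.graph t).weight e ≤ i)) := by
  have h1 := (S.graph t).mstWeight_add_sum_edgeRank W fun e he => ((hS t).2 e he).2
  have h2 := (S'.graph t).mstWeight_add_sum_edgeRank W fun e he => ((hS' t).2 e he).2
  have h3 : ∀ i, (S'.graph t).edges.filter ((S'.graph t).weight · ≤ i) =
      ((S.graph t).edges.filter ((S.graph t).weight · ≤ i)).filter (v ∉ ·) := by
    intro i
    rw [Finset.filter_congr fun e he => by rw [h.weight_eq t e he], h.edges_eq,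
      Finset.filter_comm]
  simp_rw [h3, h.edges_eq t] at h2
  have h1' : ((S.graph t).mstWeight : ℝ) = ∑ i ∈ Finset.range W, ((edgeRank (S.graph t).edges : ℝ)
      - edgeRank ((S.graph t).edges.filter ((S.graph t).weight · ≤ i))) := by
    rw [Finset.sum_sub_distrib, Finset.sum_const, Finset.card_range, nsmul_eq_mul,
      eq_sub_iff_add_eq]
    exact_mod_cast h1
  have h2' : ((S'.graph t).mstWeight : ℝ) =
      ∑ i ∈ Finset.range W, ((edgeRank ((S.graph t).edges.filter (v ∉ ·)) : ℝ)
      - edgeRank (((S.graph t).edges.filter ((S.graph t).weight · ≤ i)).filter (v ∉ ·))) := by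
    rw [Finset.sum_sub_distrib, Finset.sum_const, Finset.card_range, nsmul_eq_mul,
      eq_sub_iff_add_eq]
    exact_mod_cast h2
  rw [h1', h2', ← Finset.sum_sub_distrib]
  refine Finset.sum_congr rfl fun i _ => ?_
  have hc := Finset.card_filter_add_card_filter_not (s := (S.graph t).edges.filter (v ∈ ·))
    (fun e => (S.graph t).weight e ≤ i)
  rw [Finset.filter_comm, Finset.filter_comm (v ∈ ·) (fun e => ¬ (S.graph t).weight e ≤ i)] at hc
  have hc' : (((S.graph t).edges.filter (v ∈ ·)).card : ℝ) =
      (((S.graph t).edges.filter fun e => (S.graph t).weight e ≤ i).filter (v ∈ ·)).card +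
      (((S.graph t).edges.filter fun e => ¬ (S.graph t).weight e ≤ i).filter (v ∈ ·)).card := by
    exact_mod_cast hc.symm
  unfold starRedundancy
  rw [hc']
  ring

theorem NodeAdjacentOn.sum_abs_le (h : NodeAdjacentOn S S' v) {D W : ℕ}
    (hS : S.Bounded D W) (hS' : S'.Bounded D W) :
    ∑ t : Fin T, |(((S.graph t.succ).mstWeight : ℝ) - (S'.graph t.succ).mstWeight) -
      (((S.graph t.castSucc).mstWeight : ℝ) - (S'.graph t.castSucc).mstWeight)| ≤ 2 * D * W := by
  classical
  let P : ℕ → Fin (T + 1) → ℝ := fun i t =>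
    (((S.graph t).edges.filter fun e => ¬ (S.graph t).weight e ≤ i).filter (v ∈ ·)).card
  let U : Fin (T + 1) → ℝ := fun t => starRedundancy v (S.graph t).edges
  let L : ℕ → Fin (T + 1) → ℝ := fun i t =>
    starRedundancy v ((S.graph t).edges.filter fun e => (S.graph t).weight e ≤ i)
  have hP : ∀ i, Monotone (P i) := fun i s t hst => by
    have := Finset.card_le_card (Finset.filter_subset_filter (v ∈ ·)
      (S.sublevel_mono (fun n => ¬ n ≤ i) hst))
    exact Nat.cast_le.2 this
  have hU : Monotone U := fun s t hst => starRedundancy_mono v (S.edges_mono hst)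
  have hL : ∀ i, Monotone (L i) := fun i s t hst =>
    starRedundancy_mono v (S.sublevel_mono (fun n => n ≤ i) hst)
  have h0 := h.notMem_of_mem_edges_zero
  have hP0 : ∀ i, P i 0 = 0 := fun i => by
    simp only [P]
    rw [Finset.filter_false_of_mem fun e he => h0 e (Finset.mem_filter.1 he).1]
    simp
  have hU0 : U 0 = 0 := starRedundancy_eq_zero h0
  have hL0 : ∀ i, L i 0 = 0 := fun i =>
    starRedundancy_eq_zero fun e he => h0 e (Finset.mem_filter.1 he).1
  have hdeg : (((S.graph (Fin.last T)).edges.filter (v ∈ ·)).card : ℝ) ≤ D := by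
    have := (hS (Fin.last T)).1 v
    rw [WeightedGraph.degree, ← Finset.coe_filter, Set.ncard_coe_finset] at this
    exact_mod_cast this
  -- One `D` bounds `U`; the other bounds `P i + L i` jointly, since heavy and light star edges
  -- partition the star.
  have hlast : ∀ i, P i (Fin.last T) + U (Fin.last T) + L i (Fin.last T) ≤ 2 * D := fun i => by
    have h1 := starRedundancy_le_card v (S.graph (Fin.last T)).edges
    have h2 := starRedundancy_le_card v ((S.graph (Fin.last T)).edges.filter
      fun e => (S.graph (Fin.last T)).weight e ≤ i)
    have hc := Finset.card_filter_add_card_filter_not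
      (s := (S.graph (Fin.last T)).edges.filter (v ∈ ·))
      (fun e => (S.graph (Fin.last T)).weight e ≤ i)
    rw [Finset.filter_comm,
      Finset.filter_comm (v ∈ ·) (fun e => ¬ (S.graph (Fin.last T)).weight e ≤ i)] at hc
    have hc' : ((((S.graph (Fin.last T)).edges.filter fun e =>
        (S.graph (Fin.last T)).weight e ≤ i).filter (v ∈ ·)).card : ℝ) + P i (Fin.last T) =
        ((S.graph (Fin.last T)).edges.filter (v ∈ ·)).card := by
      simp only [P]
      exact_mod_cast hc
    simp only [U, L]
    linarith
  have hmst : ∀ t, ((S.graph t).mstWeight : ℝ) - (S'.graph t).mstWeight =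
      ∑ i ∈ Finset.range W, (P i t - U t + L i t) := h.mstWeight_sub hS hS'
  calc _ ≤ ∑ t : Fin T, ∑ i ∈ Finset.range W, (|P i t.succ - P i t.castSucc| +
        |U t.succ - U t.castSucc| + |L i t.succ - L i t.castSucc|) := by
        refine Finset.sum_le_sum fun t _ => ?_
        rw [hmst, hmst, ← Finset.sum_sub_distrib]
        refine (Finset.abs_sum_le_sum_abs _ _).trans (Finset.sum_le_sum fun i _ => ?_)
        have e : P i t.succ - U t.succ + L i t.succ -
            (P i t.castSucc - U t.castSucc + L i t.castSucc) =
            (P i t.succ - P i t.castSucc) - (U t.succ - U t.castSucc) +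
              (L i t.succ - L i t.castSucc) := by ring
        rw [e]
        exact (abs_add_le _ _).trans (add_le_add_left (abs_sub _ _) _)
    _ = ∑ i ∈ Finset.range W, (P i (Fin.last T) + U (Fin.last T) + L i (Fin.last T)) := by
        rw [Finset.sum_comm]
        refine Finset.sum_congr rfl fun i _ => ?_
        rw [Finset.sum_add_distrib, Finset.sum_add_distrib, sum_abs_sub_eq_of_monotone (hP i),
          sum_abs_sub_eq_of_monotone hU, sum_abs_sub_eq_of_monotone (hL i), hP0, hU0, hL0]
        ring
    _ ≤ ∑ i ∈ Finset.range W, (2 * D : ℝ) := Finset.sum_le_sum fun i _ => hlast i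
    _ = 2 * D * W := by rw [Finset.sum_const, Finset.card_range, nsmul_eq_mul]; ring

theorem NodeAdjacent.sum_abs_le (h : NodeAdjacent S S') {D W : ℕ}
    (hS : S.Bounded D W) (hS' : S'.Bounded D W) :
    ∑ t : Fin T, |(((S.graph t.succ).mstWeight : ℝ) - (S'.graph t.succ).mstWeight) -
      (((S.graph t.castSucc).mstWeight : ℝ) - (S'.graph t.castSucc).mstWeight)| ≤ 2 * D * W := by
  obtain ⟨v, h | h⟩ := h
  · exact h.sum_abs_le hS hS'
  · refine le_of_eq_of_le (Finset.sum_congr rfl fun t _ => ?_) (h.sum_abs_le hS' hS)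
    rw [← abs_neg]
    congr 1
    ring

theorem NodeAdjacent.graph_zero (h : NodeAdjacent S S') : S.graph 0 = S'.graph 0 := by
  obtain ⟨v, h | h⟩ := h
  · exact h.1
  · exact h.1.symm

end IncrementalSeq

theorem nodeSensitivity_mstWeight_le (V : Type*) (T D W : ℕ) :
    nodeSensitivity (fun G : WeightedGraph V => (G.mstWeight : ℝ)) T D W
      ≤ ((2 * D * W : ℕ) : ENNReal) := by
  refine iSup_le fun S => iSup_le fun S' => iSup_le fun ⟨hS, hS', h⟩ => ?_
  rw [← ENNReal.ofReal_natCast]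
  refine ENNReal.ofReal_le_ofReal ?_
  push_cast
  refine le_of_eq_of_le (Finset.sum_congr rfl fun t _ => ?_) (h.sum_abs_le hS hS')
  congr 1
  unfold IncrementalSeq.diffSeq
  ring

/-! ### Laplace noise: moment generating function, shifts and tails -/

section LaplaceNoise

open Real

theorem integral_exp_neg_abs_add_mul {c : ℝ} (h₁ : -1 < c) (h₂ : c < 1) :
    Integrable (fun x : ℝ => 1 / 2 * exp (-|x| + c * x)) ∧
      ∫ x : ℝ, 1 / 2 * exp (-|x| + c * x) = (1 - c ^ 2)⁻¹ := by
  have e1 : Set.EqOn (fun x : ℝ => exp (-|x| + c * x)) (fun x => exp ((1 + c) * x)) (Set.Iic 0) :=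
    fun x hx => by
      have : |x| = -x := abs_of_nonpos hx
      simp only [this]
      ring_nf
  have e2 : Set.EqOn (fun x : ℝ => exp (-|x| + c * x)) (fun x => exp ((c - 1) * x)) (Set.Ioi 0) :=
    fun x hx => by
      have : |x| = x := abs_of_pos hx
      simp only [this]
      ring_nf
  have i1 : IntegrableOn (fun x : ℝ => exp (-|x| + c * x)) (Set.Iic 0) :=
    (integrableOn_exp_mul_Iic (by linarith) 0).congr_fun e1.symm measurableSet_Iic
  have i2 : IntegrableOn (fun x : ℝ => exp (-|x| + c * x)) (Set.Ioi 0) :=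
    (integrableOn_exp_mul_Ioi (by linarith) 0).congr_fun e2.symm measurableSet_Ioi
  have i3 : Integrable (fun x : ℝ => exp (-|x| + c * x)) := by
    have := i1.union i2
    rwa [Set.Iic_union_Ioi, integrableOn_univ] at this
  refine ⟨i3.const_mul _, ?_⟩
  rw [integral_const_mul, ← intervalIntegral.integral_Iic_add_Ioi i1 i2,
    setIntegral_congr_fun measurableSet_Iic e1, setIntegral_congr_fun measurableSet_Ioi e2,
    integral_exp_mul_Iic (by linarith), integral_exp_mul_Ioi (by linarith)]
  have n1 : 1 + c ≠ 0 := by linarith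
  have n2 : c - 1 ≠ 0 := by linarith
  have n3 : 1 - c ^ 2 ≠ 0 := by
    have : 1 - c ^ 2 = -((1 + c) * (c - 1)) := by ring
    rw [this]
    exact neg_ne_zero.2 (mul_ne_zero n1 n2)
  simp only [mul_zero, exp_zero]
  field_simp
  ring

variable {ι : Type*} [Fintype ι]

/-- The density of a vector of independent standard Laplace random variables. -/
noncomputable def laplaceDensity (x : ι → ℝ) : ℝ := ∏ i, (1 / 2 * exp (-|x i|))

theorem laplaceDensity_nonneg (x : ι → ℝ) : 0 ≤ laplaceDensity x :=
  Finset.prod_nonneg fun _ _ => by positivity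

theorem measurable_laplaceDensity : Measurable (laplaceDensity : (ι → ℝ) → ℝ) := by
  unfold laplaceDensity
  fun_prop

theorem laplaceDensity_sub_le (x s : ι → ℝ) :
    laplaceDensity (x - s) ≤ exp (∑ i, |s i|) * laplaceDensity x := by
  unfold laplaceDensity
  rw [exp_sum, ← Finset.prod_mul_distrib]
  refine Finset.prod_le_prod (fun i _ => by positivity) fun i _ => ?_
  have h : exp (-|x i - s i|) ≤ exp |s i| * exp (-|x i|) := by
    rw [← exp_add, exp_le_exp]
    have := abs_sub_abs_le_abs_sub (x i) (s i)
    linarith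
  simp only [Pi.sub_apply]
  linarith

variable (ι) in
/-- The law of a vector of independent standard Laplace random variables. -/
noncomputable def laplaceMeasure : Measure (ι → ℝ) :=
  volume.withDensity fun x => ENNReal.ofReal (laplaceDensity x)

/-- With `c = 0` this is the total mass of the density; with `c` constant on an index set it feeds
the Chernoff bound. -/
theorem lintegral_exp_sum_mul_laplaceMeasure {c : ι → ℝ} (h₁ : ∀ i, -1 < c i)
    (h₂ : ∀ i, c i < 1) :
    ∫⁻ x, ENNReal.ofReal (exp (∑ i, c i * x i)) ∂laplaceMeasure ι =
      ENNReal.ofReal (∏ i, (1 - c i ^ 2)⁻¹) := by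
  have hprod : ∀ x : ι → ℝ, laplaceDensity x * exp (∑ i, c i * x i) =
      ∏ i, (1 / 2 * exp (-|x i| + c i * x i)) := fun x => by
    unfold laplaceDensity
    rw [exp_sum, ← Finset.prod_mul_distrib]
    refine Finset.prod_congr rfl fun i _ => ?_
    rw [exp_add, mul_assoc]
  rw [laplaceMeasure, lintegral_withDensity_eq_lintegral_mul _
    measurable_laplaceDensity.ennreal_ofReal (by fun_prop)]
  simp only [Pi.mul_apply, ← ENNReal.ofReal_mul (laplaceDensity_nonneg _), hprod]
  rw [← ofReal_integral_eq_lintegral_ofReal,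
    integral_fintype_prod_volume_eq_prod (f := fun i (y : ℝ) => 1 / 2 * exp (-|y| + c i * y))]
  · simp_rw [fun i => (integral_exp_neg_abs_add_mul (h₁ i) (h₂ i)).2]
  · exact Integrable.fintype_prod (f := fun i (y : ℝ) => 1 / 2 * exp (-|y| + c i * y))
      fun i => (integral_exp_neg_abs_add_mul (h₁ i) (h₂ i)).1
  · exact Filter.Eventually.of_forall fun x => Finset.prod_nonneg fun i _ => by positivity

instance isProbabilityMeasure_laplaceMeasure : IsProbabilityMeasure (laplaceMeasure ι) := by
  constructor
  have := lintegral_exp_sum_mul_laplaceMeasure (ι := ι) (c := fun _ => 0) (by simp) (by simp)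
  simpa using this

/-- Translation invariance of Lebesgue measure reduces this to the pointwise density ratio, bounded
by the triangle inequality. It is the source of privacy. -/
theorem laplaceMeasure_preimage_add_le (s : ι → ℝ) {E : Set (ι → ℝ)} (hE : MeasurableSet E) :
    laplaceMeasure ι ((· + s) ⁻¹' E) ≤
      ENNReal.ofReal (exp (∑ i, |s i|)) * laplaceMeasure ι E := by
  have hE' : MeasurableSet ((· + s) ⁻¹' E) := (measurable_add_const s) hE
  have hm : Measurable fun x : ι → ℝ => ENNReal.ofReal (laplaceDensity x) :=
    measurable_laplaceDensity.ennreal_ofReal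
  rw [laplaceMeasure, withDensity_apply _ hE', withDensity_apply _ hE, ← lintegral_indicator hE',
    ← lintegral_const_mul _ hm, ← lintegral_indicator hE,
    ← lintegral_sub_right_eq_self _ s]
  refine lintegral_mono fun x => ?_
  by_cases hx : x ∈ E
  · have hx' : x - s ∈ (· + s) ⁻¹' E := by simpa using hx
    rw [Set.indicator_of_mem hx', Set.indicator_of_mem hx, ← ENNReal.ofReal_mul (by positivity)]
    exact ENNReal.ofReal_le_ofReal (laplaceDensity_sub_le x s)
  · have hx' : x - s ∉ (· + s) ⁻¹' E := by simpa using hx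
    rw [Set.indicator_of_notMem hx']
    exact zero_le

/-- Bernoulli: with `k = I.card`, `(1 - l ^ 2) ^ k ≥ 1 - k * l ^ 2 = 1 / 2`. -/
theorem prod_inv_one_sub_sq_le_two [DecidableEq ι] (I : Finset ι) {l : ℝ} (hI : 0 < I.card)
    (hl : l ^ 2 = (2 * I.card : ℝ)⁻¹) :
    ∏ i, (1 - (if i ∈ I then l else 0) ^ 2)⁻¹ ≤ 2 := by
  have hc : (1 : ℝ) ≤ I.card := by exact_mod_cast hI
  have h1 : ∏ i, (1 - (if i ∈ I then l else 0) ^ 2)⁻¹ = ((1 - l ^ 2) ^ I.card)⁻¹ := by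
    rw [← inv_pow, ← Finset.prod_const, ← Finset.prod_subset (Finset.subset_univ I)]
    · exact Finset.prod_congr rfl fun i hi => by rw [if_pos hi]
    · intro i _ hi
      rw [if_neg hi]
      simp
  have hle : l ^ 2 ≤ 1 := by
    rw [hl]
    exact inv_le_one_of_one_le₀ (by linarith)
  have h2 := one_add_mul_le_pow (a := -l ^ 2) (by linarith) I.card
  have h3 : (I.card : ℝ) * l ^ 2 = 1 / 2 := by rw [hl]; field_simp
  rw [h1]
  refine inv_le_of_inv_le₀ (by norm_num) ?_
  have h4 : 1 + -l ^ 2 = 1 - l ^ 2 := by ring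
  rw [h4] at h2
  linarith

/-- Markov's inequality for the exponential. Only `l ^ 2` is prescribed, so both signs of `l`, hence
both tails, are covered. -/
theorem laplaceMeasure_sum_ge_le (I : Finset ι) (hI : 0 < I.card) {l : ℝ}
    (hl : l ^ 2 = (2 * I.card : ℝ)⁻¹) (a : ℝ) :
    laplaceMeasure ι {x | a ≤ l * ∑ i ∈ I, x i} ≤ ENNReal.ofReal (2 * exp (-a)) := by
  classical
  have hc : (1 : ℝ) ≤ I.card := by exact_mod_cast hI
  have hl2 : l ^ 2 < 1 := by
    rw [hl]
    exact inv_lt_one_of_one_lt₀ (by linarith)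
  have hl1 : |l| < 1 := by
    rwa [← sq_lt_one_iff_abs_lt_one]
  have hsum : ∀ x : ι → ℝ, l * ∑ i ∈ I, x i = ∑ i, (if i ∈ I then l else 0) * x i := fun x => by
    rw [Finset.mul_sum, ← Finset.sum_subset (Finset.subset_univ I)]
    · exact Finset.sum_congr rfl fun i hi => by rw [if_pos hi]
    · intro i _ hi
      rw [if_neg hi, zero_mul]
  have hlint := lintegral_exp_sum_mul_laplaceMeasure (ι := ι)
    (c := fun i => if i ∈ I then l else 0)
    (fun i => by split_ifs; exacts [(abs_lt.1 hl1).1, by norm_num])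
    (fun i => by split_ifs; exacts [(abs_lt.1 hl1).2, by norm_num])
  have hmarkov := mul_meas_ge_le_lintegral (μ := laplaceMeasure ι)
    (f := fun x => ENNReal.ofReal (exp (∑ i, (if i ∈ I then l else 0) * x i)))
    (by fun_prop) (ENNReal.ofReal (exp a))
  rw [hlint] at hmarkov
  have hset : {x : ι → ℝ | a ≤ l * ∑ i ∈ I, x i} = {x | ENNReal.ofReal (exp a) ≤
      ENNReal.ofReal (exp (∑ i, (if i ∈ I then l else 0) * x i))} := by
    ext x
    simp only [Set.mem_ofPred_eq, hsum, ENNReal.ofReal_le_ofReal_iff (exp_pos _).le, exp_le_exp]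
  rw [hset]
  calc _ = ENNReal.ofReal (exp (-a)) * (ENNReal.ofReal (exp a) * laplaceMeasure ι
        {x | ENNReal.ofReal (exp a) ≤
          ENNReal.ofReal (exp (∑ i, (if i ∈ I then l else 0) * x i))}) := by
        rw [← mul_assoc, ← ENNReal.ofReal_mul (exp_pos _).le, ← exp_add]
        simp
    _ ≤ ENNReal.ofReal (exp (-a)) * ENNReal.ofReal 2 := by
        refine mul_le_mul_right (hmarkov.trans ?_) _
        exact ENNReal.ofReal_le_ofReal (prod_inv_one_sub_sq_le_two I hI hl)
    _ = _ := by rw [← ENNReal.ofReal_mul (exp_pos _).le, mul_comm]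

theorem laplaceMeasure_abs_sum_ge_le (I : Finset ι) (hI : 0 < I.card) (a : ℝ) :
    (laplaceMeasure ι).real {x | a ≤ |(∑ i ∈ I, x i) / √(2 * I.card)|} ≤ 4 * exp (-a) := by
  have hc : (1 : ℝ) ≤ I.card := by exact_mod_cast hI
  have hl : ((√(2 * I.card))⁻¹) ^ 2 = (2 * I.card : ℝ)⁻¹ := by
    rw [inv_pow, sq_sqrt (by positivity)]
  have hl' : (-(√(2 * I.card))⁻¹) ^ 2 = (2 * I.card : ℝ)⁻¹ := by rw [neg_sq, hl]
  have h1 := laplaceMeasure_sum_ge_le I hI hl a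
  have h2 := laplaceMeasure_sum_ge_le I hI hl' a
  refine ENNReal.toReal_le_of_le_ofReal (by positivity) ?_
  have hsub : {x : ι → ℝ | a ≤ |(∑ i ∈ I, x i) / √(2 * I.card)|} ⊆
      {x | a ≤ (√(2 * I.card))⁻¹ * ∑ i ∈ I, x i} ∪
        {x | a ≤ -(√(2 * I.card))⁻¹ * ∑ i ∈ I, x i} := by
    intro x hx
    have hx' : a ≤ |(√(2 * I.card))⁻¹ * ∑ i ∈ I, x i| := by
      rwa [Set.mem_ofPred_eq, div_eq_inv_mul] at hx
    rcases le_abs.1 hx' with h | h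
    · exact Or.inl h
    · exact Or.inr (by rwa [Set.mem_ofPred_eq, neg_mul])
  calc _ ≤ _ := measure_mono hsub
    _ ≤ _ := measure_union_le _ _
    _ ≤ ENNReal.ofReal (2 * exp (-a)) + ENNReal.ofReal (2 * exp (-a)) := add_le_add h1 h2
    _ = ENNReal.ofReal (4 * exp (-a)) := by
      rw [← ENNReal.ofReal_add (by positivity) (by positivity)]
      ring_nf

end LaplaceNoise

/-! ### Uniform smoothing for confidence levels near zero -/

section UniformSmoothing

open Real

/-- The uniform distribution on `[-1/2, 1/2]`. -/
noncomputable def uniformMeasure : Measure ℝ := volume.restrict (Set.Icc (-(1 / 2)) (1 / 2))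

instance isProbabilityMeasure_uniformMeasure : IsProbabilityMeasure uniformMeasure :=
  ⟨by simp only [uniformMeasure, Measure.restrict_apply_univ, volume_Icc]; norm_num⟩

/-- The condition on `|y| + r` says that the solution interval, of length `2r/24`, lies inside
`[-1/2, 1/2]`. -/
theorem uniformMeasure_abs_add_le {y r : ℝ} (h : |y| + r ≤ 12) :
    ENNReal.ofReal (r / 12) ≤ uniformMeasure {u | |y + 24 * u| ≤ r} := by
  have hy := abs_le.1 (le_refl |y|)
  have hsub : Set.Icc ((-y - r) / 24) ((-y + r) / 24) ⊆
      {u | |y + 24 * u| ≤ r} ∩ Set.Icc (-(1 / 2)) (1 / 2) := by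
    rintro u ⟨h1, h2⟩
    rw [Set.mem_inter_iff, Set.mem_ofPred_eq, abs_le]
    refine ⟨⟨?_, ?_⟩, ?_, ?_⟩ <;> linarith
  have hm : MeasurableSet {u : ℝ | |y + 24 * u| ≤ r} :=
    measurableSet_le (by fun_prop) measurable_const
  rw [uniformMeasure, Measure.restrict_apply hm]
  refine le_of_eq_of_le ?_ (measure_mono hsub)
  rw [volume_Icc]
  congr 1
  ring

/-- Adding bounded uniform noise to a random variable with exponential tails makes the
concentration bound effective also at confidence levels close to `0`. -/
theorem le_prod_uniformMeasure_abs_add_le {Ω : Type*} [MeasurableSpace Ω] {μ : Measure Ω}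
    [IsProbabilityMeasure μ] {Y : Ω → ℝ} (hY : Measurable Y)
    (htail : ∀ a, μ.real {ω | a ≤ |Y ω|} ≤ 4 * exp (-a)) {s : ℝ} (hs : 0 < s) :
    1 - exp (-s) ≤ (μ.prod uniformMeasure).real {p | |Y p.1 + 24 * p.2| ≤ 30 * s} := by
  have hlt : ∀ a, 1 - 4 * exp (-a) ≤ μ.real {ω | |Y ω| < a} := fun a => by
    have hset : {ω | |Y ω| < a} = {ω | a ≤ |Y ω|}ᶜ := by ext; simp
    rw [hset, probReal_compl_eq_one_sub (measurableSet_le measurable_const hY.abs)]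
    linarith [htail a]
  -- For `s ≥ 1/2` the tail bound suffices: the smoothing costs at most 12, and `30 * s - 12 ≥ s +
  -- 2`, where `exp (-2)` absorbs the factor 4. For smaller `s` the uniform density does the work on
  -- the event `|Y| < 3`.
  rcases le_or_gt (1 / 2) s with h | h
  · have hsub : {ω | |Y ω| < 30 * s - 12} ×ˢ Set.Icc (-(1 / 2) : ℝ) (1 / 2) ⊆
        {p : Ω × ℝ | |Y p.1 + 24 * p.2| ≤ 30 * s} := by
      rintro ⟨ω, u⟩ ⟨h1, h2, h3⟩
      rw [Set.mem_ofPred_eq, abs_lt] at h1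
      rw [Set.mem_ofPred_eq, abs_le]
      simp only at h1 h2 h3 ⊢
      constructor <;> linarith
    have hU : uniformMeasure.real (Set.Icc (-(1 / 2) : ℝ) (1 / 2)) = 1 := by
      simp only [Measure.real, uniformMeasure, Measure.restrict_apply_self, volume_Icc]
      norm_num
    refine le_trans ?_ (measureReal_mono hsub)
    rw [measureReal_prod_prod, hU, mul_one]
    refine le_trans ?_ (hlt _)
    have hexp : exp (-(30 * s - 12)) ≤ exp (-s) * exp (-2) := by
      rw [← exp_add, exp_le_exp]
      linarith
    have h4 : 4 * exp (-2) ≤ 1 := by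
      have : exp 2 = exp 1 * exp 1 := by rw [← exp_add]; norm_num
      have h1 := exp_one_gt_d9
      rw [exp_neg, this, ← div_eq_mul_inv, div_le_one (by positivity)]
      nlinarith
    nlinarith [exp_pos (-s)]
  · have h34 : 3 / 4 ≤ μ.real {ω | |Y ω| < 3} := by
      refine le_trans ?_ (hlt 3)
      have : exp 3 = exp 1 * exp 1 * exp 1 := by rw [← exp_add, ← exp_add]; norm_num
      have h1 := exp_one_gt_d9
      have h16 : 16 ≤ exp 3 := by
        rw [this]
        have : 7.3 ≤ exp 1 * exp 1 := by nlinarith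
        nlinarith
      have : exp (-3) ≤ 1 / 16 := by
        rw [exp_neg, ← one_div]
        exact one_div_le_one_div_of_le (by norm_num) h16
      linarith
    -- The cap 9 keeps `|Y| + r ≤ 12` on the event `|Y| < 3`.
    set r := min (30 * s) 9 with hr
    have hr0 : 0 ≤ r := le_min (by linarith) (by norm_num)
    have hm : MeasurableSet {p : Ω × ℝ | |Y p.1 + 24 * p.2| ≤ 30 * s} :=
      measurableSet_le (by fun_prop) measurable_const
    have hm3 : MeasurableSet {ω | |Y ω| < 3} := measurableSet_lt hY.abs measurable_const
    have hlow : ENNReal.ofReal (r / 12) * μ {ω | |Y ω| < 3} ≤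
        (μ.prod uniformMeasure) {p | |Y p.1 + 24 * p.2| ≤ 30 * s} := by
      rw [Measure.prod_apply hm, ← setLIntegral_const]
      refine le_trans ?_ (setLIntegral_le_lintegral {ω | |Y ω| < 3} _)
      refine setLIntegral_mono' hm3 fun ω hω => ?_
      have hω' : |Y ω| < 3 := hω
      refine (uniformMeasure_abs_add_le (y := Y ω) (r := r) ?_).trans (measure_mono ?_)
      · linarith [min_le_right (30 * s) 9]
      · intro u hu
        exact le_trans hu (min_le_left (30 * s) 9)
    have hlow' := ENNReal.toReal_mono (measure_ne_top _ _) hlow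
    rw [ENNReal.toReal_mul, ENNReal.toReal_ofReal (by positivity)] at hlow'
    refine le_trans ?_ hlow'
    have h5 : s ≤ r / 12 * (3 / 4) := by
      rcases min_choice (30 * s) 9 with h' | h' <;> rw [hr, h'] <;> linarith
    have h6 : r / 12 * (3 / 4) ≤ r / 12 * (μ {ω | |Y ω| < 3}).toReal :=
      mul_le_mul_of_nonneg_left h34 (by positivity)
    linarith [add_one_le_exp (-s)]

end UniformSmoothing

/-! ### Dyadic decomposition of sequences of bounded variation -/

section DyadicDecomposition

/-- Level `l` accounts for the step from `n` rounded down to a multiple of `2 ^ l` to `n` rounded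
down to a multiple of `2 ^ (l + 1)`. -/
theorem sum_range_dyadic_telescope (A : ℕ → ℝ) {n L : ℕ} (hn : n < 2 ^ L) :
    ∑ l ∈ Finset.range L, (A (n / 2 ^ l * 2 ^ l) - A (n / 2 ^ l / 2 * 2 * 2 ^ l)) =
      A n - A 0 := by
  have h : ∀ l, n / 2 ^ l / 2 * 2 * 2 ^ l = n / 2 ^ (l + 1) * 2 ^ (l + 1) := fun l => by
    rw [Nat.div_div_eq_div_mul, ← pow_succ, mul_assoc, ← pow_succ']
  simp_rw [h]
  rw [Finset.sum_range_sub' (fun l => A (n / 2 ^ l * 2 ^ l)), Nat.div_eq_of_lt hn]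
  simp

theorem sum_range_abs_block_le (A : ℕ → ℝ) (m k : ℕ) :
    ∑ p ∈ Finset.range k, |A ((p + 1) * m) - A (p * m)| ≤
      ∑ j ∈ Finset.range (k * m), |A (j + 1) - A j| := by
  induction k with
  | zero => simp
  | succ k ih =>
    have hle : k * m ≤ (k + 1) * m := Nat.mul_le_mul_right m (Nat.le_succ k)
    rw [Finset.sum_range_succ, ← Finset.sum_range_add_sum_Ico _ hle]
    refine add_le_add ih ?_
    have := dist_le_Ico_sum_dist A hle
    simp_rw [Real.dist_eq] at this
    rw [abs_sub_comm]
    exact this.trans_eq (Finset.sum_congr rfl fun j _ => abs_sub_comm _ _)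

/-- Even positions contribute nothing and odd ones a single block increment, so one level costs at
most the total variation. -/
theorem sum_range_abs_dyadic_le (A : ℕ → ℝ) {R : ℝ}
    (hR : ∀ k, ∑ j ∈ Finset.range k, |A (j + 1) - A j| ≤ R) (m k : ℕ) :
    ∑ q ∈ Finset.range (k + 1), |A (q * m) - A (q / 2 * 2 * m)| ≤ R := by
  rw [Finset.sum_range_succ']
  refine le_trans ?_ ((sum_range_abs_block_le A m k).trans (hR _))
  have h0 : |A (0 * m) - A (0 / 2 * 2 * m)| = 0 := by simp
  rw [h0, add_zero]
  refine Finset.sum_le_sum fun p _ => ?_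
  rcases Nat.even_or_odd' p with ⟨r, rfl | rfl⟩
  · have : (2 * r + 1) / 2 * 2 = 2 * r := by omega
    rw [this]
  · have : (2 * r + 1 + 1) / 2 * 2 = 2 * r + 1 + 1 := by omega
    rw [this, sub_self, abs_zero]
    exact abs_nonneg _

/-- The nodes of the binary tree with time steps `1, …, T` as its leaves: a node consists of its
level and its position in the level. -/
abbrev DyadicNode (T : ℕ) : Type := Fin (Nat.log 2 T + 1) × Fin (T + 1)

/-- The node at level `l` used to decompose the first `t + 1` time steps. -/
def dyadicNodeAt {T : ℕ} (t : Fin T) (l : Fin (Nat.log 2 T + 1)) : DyadicNode T :=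
  (l, ⟨(t + 1) / 2 ^ (l : ℕ), (Nat.div_le_self _ _).trans_lt (by omega)⟩)

/-- The nodes used to decompose the first `t + 1` time steps. -/
def dyadicPath {T : ℕ} (t : Fin T) : Finset (DyadicNode T) :=
  Finset.univ.image (dyadicNodeAt t)

theorem dyadicNodeAt_injective {T : ℕ} (t : Fin T) : Function.Injective (dyadicNodeAt t) :=
  fun _ _ h => congrArg Prod.fst h

theorem card_dyadicPath {T : ℕ} (t : Fin T) : (dyadicPath t).card = Nat.log 2 T + 1 := by
  rw [dyadicPath, Finset.card_image_of_injective _ (dyadicNodeAt_injective t), Finset.card_univ,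
    Fintype.card_fin]

theorem sum_dyadicPath {T : ℕ} (t : Fin T) (x : DyadicNode T → ℝ) :
    ∑ i ∈ dyadicPath t, x i = ∑ l, x (dyadicNodeAt t l) :=
  Finset.sum_image fun _ _ _ _ h => dyadicNodeAt_injective t h

/-- Every sequence of total variation at most `R` can be written as the sequence of path sums of a
vector on the dyadic nodes with small `ℓ¹` norm. -/
theorem exists_sum_dyadicPath_eq {T : ℕ} (a : Fin (T + 1) → ℝ) (h0 : a 0 = 0) {R : ℝ}
    (hR : ∑ t : Fin T, |a t.succ - a t.castSucc| ≤ R) :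
    ∃ x : DyadicNode T → ℝ, (∀ t : Fin T, ∑ i ∈ dyadicPath t, x i = a t.succ) ∧
      ∑ i, |x i| ≤ (Nat.log 2 T + 1 : ℕ) * R := by
  -- Freezing the sequence after `T` adds no variation and gives meaning to nodes whose block
  -- reaches beyond `T`.
  let A : ℕ → ℝ := fun n => a ⟨min n T, by omega⟩
  have hA : ∀ n (hn : n ≤ T), A n = a ⟨n, by omega⟩ := fun n hn => by
    simp only [A, min_eq_left hn]
  have hAT : ∑ j ∈ Finset.range T, |A (j + 1) - A j| ≤ R := by
    rw [Finset.sum_range]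
    refine le_of_eq_of_le (Finset.sum_congr rfl fun j _ => ?_) hR
    rw [hA _ (by omega), hA _ (by omega)]
    rfl
  have hAk : ∀ k, ∑ j ∈ Finset.range k, |A (j + 1) - A j| ≤ R := fun k => by
    refine le_trans ?_ hAT
    rcases le_total k T with h | h
    · exact Finset.sum_le_sum_of_subset_of_nonneg (Finset.range_mono h) fun _ _ _ => abs_nonneg _
    · refine (Finset.sum_subset (Finset.range_mono h) fun j _ hj => ?_).ge
      have hj' : T ≤ j := by simpa using hj
      simp only [A, min_eq_right hj', min_eq_right (hj'.trans (Nat.le_succ j)), sub_self, abs_zero]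
  refine ⟨fun i => A (i.2 * 2 ^ (i.1 : ℕ)) - A (i.2 / 2 * 2 * 2 ^ (i.1 : ℕ)), fun t => ?_, ?_⟩
  · have hlt : (t : ℕ) + 1 < 2 ^ (Nat.log 2 T + 1) :=
      lt_of_le_of_lt (by omega) (Nat.lt_pow_succ_log_self one_lt_two T)
    have h := sum_range_dyadic_telescope A hlt
    rw [Finset.sum_range, hA _ (by omega), hA 0 (Nat.zero_le _)] at h
    have h0' : a ⟨0, by omega⟩ = 0 := h0
    rw [sum_dyadicPath]
    simp only [dyadicNodeAt]
    rw [h, h0', sub_zero]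
    rfl
  · rw [Fintype.sum_prod_type]
    calc _ ≤ ∑ _l : Fin (Nat.log 2 T + 1), R := Finset.sum_le_sum fun l _ => by
          rw [Fin.sum_univ_eq_sum_range
            (fun q => |A (q * 2 ^ (l : ℕ)) - A (q / 2 * 2 * 2 ^ (l : ℕ))|)]
          exact sum_range_abs_dyadic_le A hAk _ _
      _ = _ := by simp

end DyadicDecomposition

/-! ### The binary tree mechanism: privacy and accuracy -/

theorem ContinualAlgorithm.pr_mono {V : Type*} {T : ℕ} (A : ContinualAlgorithm V T)
    {p q : A.Coins → Prop} (h : ∀ ω, p ω → q ω) : A.pr p ≤ A.pr q := by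
  let _ := A.measurableSpace
  have _ := A.isProbabilityMeasure
  exact measureReal_mono (μ := A.law) h

/-- The binary tree mechanism for the weight of a minimum spanning tree: Laplace noise of scale `b`
at the dyadic nodes, followed by uniform smoothing. -/
noncomputable def mstTreeMechanism (V : Type*) (T : ℕ) (b : ℝ) : ContinualAlgorithm V T where
  Coins := (DyadicNode T → ℝ) × ℝ
  law := (laplaceMeasure (DyadicNode T)).prod uniformMeasure
  output S ω t := (S.graph t.succ).mstWeight +
    b * (∑ i ∈ dyadicPath t, ω.1 i + √(2 * (Nat.log 2 T + 1 : ℕ)) * (24 * ω.2))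
  measurable_output S := by fun_prop
  causal S S' t h ω := by rw [h t.succ le_rfl]

/-- The scale `b` is the `ℓ¹` norm bound of the dyadic vector divided by `ε`, so the rescaled shift
has norm at most `ε`. -/
theorem mstTreeMechanism_nodePrivate (V : Type*) (T D W : ℕ) {ε : ℝ} (hε : 0 < ε) :
    (mstTreeMechanism V T (2 * D * W * (Nat.log 2 T + 1 : ℕ) * ε⁻¹)).NodePrivate ε D W := by
  intro S S' hS hS' hadj B hB
  set b : ℝ := 2 * D * W * (Nat.log 2 T + 1 : ℕ) * ε⁻¹ with hb
  have hb0 : 0 ≤ b := by positivity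
  obtain ⟨x, hx, hxle⟩ := exists_sum_dyadicPath_eq
    (fun t => ((S.graph t).mstWeight : ℝ) - (S'.graph t).mstWeight)
    (by rw [hadj.graph_zero, sub_self]) (hadj.sum_abs_le hS hS')
  have hxle' : ∑ i, |x i| ≤ b * ε := by
    rw [hb, mul_assoc, inv_mul_cancel₀ hε.ne', mul_one]
    linarith
  let s : DyadicNode T → ℝ := fun i => x i / b
  -- If `b = 0` (that is, `D` or `W` is zero), the norm bound forces `x = 0`, so division by zero
  -- does no harm.
  have hs : ∀ i, b * s i = x i := fun i => by
    rcases hb0.eq_or_lt with h | h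
    · have h1 : |x i| ≤ ∑ i, |x i| :=
        Finset.single_le_sum (fun j _ => abs_nonneg (x j)) (Finset.mem_univ i)
      rw [← h, zero_mul] at hxle'
      rw [← h, zero_mul, eq_comm, ← abs_nonpos_iff]
      exact h1.trans hxle'
    · exact mul_div_cancel₀ _ h.ne'
  have hsle : ∑ i, |s i| ≤ ε := by
    simp only [s, abs_div, abs_of_nonneg hb0]
    rw [← Finset.sum_div]
    exact div_le_of_le_mul₀ hb0 hε.le (by linarith)
  let μ := laplaceMeasure (DyadicNode T)
  let A := mstTreeMechanism V T b
  let F : IncrementalSeq V T → (DyadicNode T → ℝ) × ℝ → Fin T → ℝ := A.output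
  have hF : ∀ y u, F S (y, u) = F S' (y + s, u) := fun y u => by
    funext t
    have h1 : ∑ i ∈ dyadicPath t, b * s i =
        ((S.graph t.succ).mstWeight : ℝ) - (S'.graph t.succ).mstWeight := by
      rw [← hx t]
      exact Finset.sum_congr rfl fun i _ => hs i
    rw [← Finset.mul_sum] at h1
    simp only [F, A, mstTreeMechanism, Pi.add_apply, Finset.sum_add_distrib]
    linarith
  have hFm : ∀ S, MeasurableSet (F S ⁻¹' B) := fun S => A.measurable_output S hB
  -- The uniform variable enters both runs identically, so the shift bound applies for each fixed
  -- `u` and is then integrated.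
  have key : (μ.prod uniformMeasure) (F S ⁻¹' B) ≤
      ENNReal.ofReal (Real.exp ε) * (μ.prod uniformMeasure) (F S' ⁻¹' B) := by
    rw [Measure.prod_apply_symm (hFm S), Measure.prod_apply_symm (hFm S'),
      ← lintegral_const_mul _ (measurable_measure_prodMk_right (hFm S'))]
    refine lintegral_mono fun u => ?_
    have hset : (fun y => (y, u)) ⁻¹' (F S ⁻¹' B) =
        (· + s) ⁻¹' ((fun y => (y, u)) ⁻¹' (F S' ⁻¹' B)) := by
      ext y
      simp only [Set.mem_preimage, hF]
    simp only [hset]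
    refine (laplaceMeasure_preimage_add_le s (measurable_prodMk_right (hFm S'))).trans ?_
    exact mul_le_mul_left (ENNReal.ofReal_le_ofReal (Real.exp_le_exp.2 hsle)) _
  have := ENNReal.toReal_mono
    (ENNReal.mul_ne_top ENNReal.ofReal_ne_top (measure_ne_top _ _)) key
  rwa [ENNReal.toReal_mul, ENNReal.toReal_ofReal (Real.exp_pos _).le] at this

/-- For `T ≥ 2`, both `log₂ T` and 1 are at most `log T / log 2`, and `2 / log 2 < 3`. One factor of
the level count comes from the noise scale, the square root from the path sum. -/
theorem natLog_add_one_mul_sqrt_le {T : ℕ} (hT : 2 ≤ T) :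
    ((Nat.log 2 T + 1 : ℕ) : ℝ) * √(2 * (Nat.log 2 T + 1 : ℕ)) ≤
      9 * Real.log T ^ (3 / 2 : ℝ) := by
  have hT' : (2 : ℝ) ≤ T := by exact_mod_cast hT
  have hl2 := Real.log_two_gt_d9
  have h1 : Real.log 2 ≤ Real.log T := Real.log_le_log (by norm_num) hT'
  have h2 : (Nat.log 2 T : ℝ) ≤ Real.logb 2 T := Real.natLog_le_logb T 2
  have h3 : (Nat.log 2 T : ℝ) * Real.log 2 ≤ Real.log T := by
    rw [Real.logb] at h2
    rwa [le_div_iff₀ (by linarith)] at h2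
  have h0 : (0 : ℝ) ≤ Nat.log 2 T := Nat.cast_nonneg _
  have hL : ((Nat.log 2 T + 1 : ℕ) : ℝ) ≤ 3 * Real.log T := by
    push_cast
    nlinarith
  have hpow : Real.log T ^ (3 / 2 : ℝ) = Real.log T * √(Real.log T) := by
    rw [show (3 / 2 : ℝ) = 1 + 1 / 2 by norm_num, Real.rpow_add (by linarith), Real.rpow_one,
      Real.sqrt_eq_rpow]
  have hsqrt : √(2 * (Nat.log 2 T + 1 : ℕ)) ≤ 3 * √(Real.log T) := by
    rw [Real.sqrt_le_left (by positivity), mul_pow, Real.sq_sqrt (by linarith)]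
    linarith
  calc _ ≤ 3 * Real.log T * (3 * √(Real.log T)) :=
        mul_le_mul hL hsqrt (Real.sqrt_nonneg _) (by linarith)
    _ = _ := by rw [hpow]; ring

theorem le_pr_mstTreeMechanism (V : Type*) {T : ℕ} {b : ℝ} (hb : 0 ≤ b) {s : ℝ}
    (hs : 0 < s) (S : IncrementalSeq V T) (t : Fin T) :
    1 - Real.exp (-s) ≤ (mstTreeMechanism V T b).pr fun ω =>
      |(mstTreeMechanism V T b).output S ω t - ((S.graph t.succ).mstWeight : ℝ)| ≤
        b * (√(2 * (Nat.log 2 T + 1 : ℕ)) * (30 * s)) := by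
  let N : ℝ := √(2 * (Nat.log 2 T + 1 : ℕ))
  have hN : 0 < N := Real.sqrt_pos.2 (by positivity)
  have htail : ∀ a, (laplaceMeasure (DyadicNode T)).real
      {x | a ≤ |(∑ i ∈ dyadicPath t, x i) / N|} ≤ 4 * Real.exp (-a) := fun a => by
    have := laplaceMeasure_abs_sum_ge_le (dyadicPath t) (by rw [card_dyadicPath]; omega) a
    rwa [card_dyadicPath] at this
  refine (le_prod_uniformMeasure_abs_add_le (by fun_prop) htail hs).trans ?_
  refine measureReal_mono (μ := (laplaceMeasure (DyadicNode T)).prod uniformMeasure) ?_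
  rintro ⟨x, u⟩ h
  rw [Set.mem_ofPred_eq] at h
  have e : (mstTreeMechanism V T b).output S (x, u) t - ((S.graph t.succ).mstWeight : ℝ) =
      b * (N * ((∑ i ∈ dyadicPath t, x i) / N + 24 * u)) := by
    simp only [mstTreeMechanism]
    rw [mul_add N, mul_div_cancel₀ _ hN.ne']
    ring
  have hle : |(mstTreeMechanism V T b).output S (x, u) t - ((S.graph t.succ).mstWeight : ℝ)| ≤
      b * (N * (30 * s)) := by
    rw [e, abs_mul, abs_mul, abs_of_nonneg hb, abs_of_pos hN]
    exact mul_le_mul_of_nonneg_left (mul_le_mul_of_nonneg_left h hN.le) hb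
  exact hle

theorem mainTheorem5 :
    (∀ (V : Type*) (T D W : ℕ),
      nodeSensitivity (fun G : WeightedGraph V => (G.mstWeight : ℝ)) T D W
        ≤ ((2 * D * W : ℕ) : ENNReal)) ∧
    ∃ C : ℝ, 0 < C ∧
      ∀ (V : Type*) (T D W : ℕ) (ε : ℝ), 2 ≤ T → 0 < ε →
        ∃ A : ContinualAlgorithm V T,
          A.NodePrivate ε D W ∧
          ∀ δ : ℝ, 0 < δ → δ < 1 →
            ∀ S : IncrementalSeq V T, S.Bounded D W → ∀ t : Fin T,
              1 - δ ≤ A.pr (fun ω =>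
                |A.output S ω t - ((S.graph t.succ).mstWeight : ℝ)|
                  ≤ C * ((D : ℝ) * (W : ℝ) * ε⁻¹ * (Real.log T) ^ (3 / 2 : ℝ)
                      * Real.log δ⁻¹)) := by
  -- `540 = 2 * 30 * 9`: sensitivity, smoothed tail bound, and conversion of the level count to `log
  -- T`.
  refine ⟨nodeSensitivity_mstWeight_le, 540, by norm_num, fun V T D W ε hT hε =>
    ⟨_, mstTreeMechanism_nodePrivate V T D W hε, fun δ hδ hδ1 S _ t => ?_⟩⟩
  set b : ℝ := 2 * D * W * (Nat.log 2 T + 1 : ℕ) * ε⁻¹ with hb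
  have hs : 0 < Real.log δ⁻¹ := Real.log_pos ((one_lt_inv₀ hδ).2 hδ1)
  have h := le_pr_mstTreeMechanism V (b := b) (by positivity) hs S t
  rw [Real.log_inv, neg_neg, Real.exp_log hδ, ← Real.log_inv] at h
  refine h.trans (ContinualAlgorithm.pr_mono _ fun ω hω => hω.trans ?_)
  have hfac : 0 ≤ 60 * (D * W * ε⁻¹ * Real.log δ⁻¹) := by positivity
  have := mul_le_mul_of_nonneg_left (natLog_add_one_mul_sqrt_le hT) hfac
  rw [hb]
  linarith
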